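/- A variety of monoids is a class of monoids closed under homomorphic images, submonoids and arbitrary direct products; $\mathbb V\vee\mathbb W$ is the smallest variety containing $\mathbb V$ and $\mathbb W$; $\overline{\mathbb V}$ is the variety of all monoids anti-isomorphic to members of $\mathbb V$. For a set $\Sigma$ of identities between words over a countably infinite alphabet, $\operatorname{var}\Sigma$ is the class of all monoids satisfying $\Sigma$; $\Sigma$ is a basis of $\mathbb V$ if $\mathbb V=\operatorname{var}\Sigma$, and $\mathbb V$ is finitely based if it has a finite basis. Let $$E=\langle a,b,c\mid a^2=ab=0,\ ba=ca=a,\ b^2=bc=b,\ c^2=cb=c\rangle$$ (a semigroup with zero, with the five elements $a,b,c,ac,0$), let $E^1$ be the monoid obtained from $E$ by adjoining a new identity element, and let $\mathbb E^1$ be the monoid variety generated by $E^1$. Let $$\mathbb R_3^1=\operatorname{var}\{x\approx x^2,\ xyz\approx xyxzxyz\}.$$ Then the monoid variety $\mathbb E^1\vee\overline{\mathbb E^1}\vee\mathbb R_3^1$ is finitely based, and $$\mathbb E^1\vee\overline{\mathbb E^1}\vee\mathbb R_3^1=\operatorname{var}\{xtx\approx xtx^2\approx x^2tx,\ x^2y^2\approx(xy)^2,\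 xyt^2xsy\approx xyxt^2xsy\}$$ $$=\operatorname{var}\{xtx\approx xtx^2\approx x^2tx,\ x^2y^2\approx(xy)^2,\ xyt^2ysx\approx xyxt^2ysx\}.$$ -/

import Mathlib

universe u

namespace MonoidVar

/-- Words over the countably infinite alphabet `ℕ`, including the empty word. -/
abbrev Word : Type := FreeMonoid ℕ

/-- An identity `u ≈ v` between words, written as the pair `(u, v)`. -/
abbrev Identity : Type := Word × Word

/-- The monoid `M` satisfies the identity `u ≈ v`: every substitution of elements of `M` for
the letters, that is, every homomorphism from the free monoid, equates the two sides. -/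
def Satisfies (M : Type u) [Monoid M] (e : Identity) : Prop :=
  ∀ φ : Word →* M, φ e.1 = φ e.2

/-- A variety of monoids: a class of monoids closed under homomorphic images, submonoids and
arbitrary direct products. -/
structure IsVariety (V : Set MonCat.{u}) : Prop where
  image : ∀ M ∈ V, ∀ (N : MonCat.{u}) (f : M →* N), Function.Surjective f → N ∈ V
  submonoid : ∀ M ∈ V, ∀ S : Submonoid M, MonCat.of S ∈ V
  pi : ∀ (ι : Type u) (M : ι → MonCat.{u}), (∀ i, M i ∈ V) → MonCat.of (∀ i, M i) ∈ V

/-- The smallest variety containing the class `K`. -/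
def generated (K : Set MonCat.{u}) : Set MonCat.{u} :=
  ⋂₀ {V | IsVariety V ∧ K ⊆ V}

/-- The join of two varieties. -/
def join (V W : Set MonCat.{u}) : Set MonCat.{u} := generated (V ∪ W)

/-- The dual of a variety: the monoids anti-isomorphic to its members. -/
def dual (V : Set MonCat.{u}) : Set MonCat.{u} :=
  {M | ∃ N ∈ V, Nonempty (M ≃* (N : Type u)ᵐᵒᵖ)}

/-- The class `var Σ` of all monoids that satisfy every identity of `Σ`. -/
def var (I : Set Identity) : Set MonCat.{u} := {M | ∀ e ∈ I, Satisfies M e}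

/-- `I` is a basis of identities of the class `V`. -/
def IsBasis (I : Set Identity) (V : Set MonCat.{u}) : Prop := V = var I

/-- A class is finitely based if it has a finite basis of identities. -/
def FinitelyBased (V : Set MonCat.{u}) : Prop :=
  ∃ I : Set Identity, I.Finite ∧ IsBasis I V

/-- The elements of the semigroup with zero
`E = ⟨a, b, c ∣ a² = ab = 0, ba = ca = a, b² = bc = b, c² = cb = c⟩`;
`ac` is the product of `a` and `c`. -/
inductive E : Type
  | zero | a | b | c | ac
  deriving DecidableEq

namespace E

/-- The multiplication of `E`. -/
def mul : E → E → E
  | zero, _ => zero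
  | a, c => ac
  | a, _ => zero
  | b, zero => zero
  | b, a => a
  | b, b => b
  | b, c => b
  | b, ac => ac
  | c, zero => zero
  | c, a => a
  | c, b => c
  | c, c => c
  | c, ac => ac
  | ac, b => ac
  | ac, c => ac
  | ac, _ => zero

instance : SemigroupWithZero E where
  mul := mul
  zero := zero
  mul_assoc x y z := by cases x <;> cases y <;> cases z <;> rfl
  zero_mul x := by cases x <;> rfl
  mul_zero x := by cases x <;> rfl

/-- The defining relations of the presentation, for elements `p`, `q`, `r` of a semigroup
with zero in place of `a`, `b`, `c`. -/
def Rel {S : Type*} [SemigroupWithZero S] (p q r : S) : Prop :=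
  p * p = 0 ∧ p * q = 0 ∧ q * p = p ∧ r * p = p ∧
    q * q = q ∧ q * r = q ∧ r * r = r ∧ r * q = r

theorem rel : Rel a b c := ⟨rfl, rfl, rfl, rfl, rfl, rfl, rfl, rfl⟩

/-- `E` is the semigroup with zero given by the presentation: its generators satisfy the
relations, and `E` maps uniquely to every semigroup with zero with three such elements. -/
theorem existsUnique_hom {S : Type*} [SemigroupWithZero S] (p q r : S) (h : Rel p q r) :
    ∃! f : E → S, f 0 = 0 ∧ (∀ x y, f (x * y) = f x * f y) ∧ f a = p ∧ f b = q ∧ f c = r := by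
  obtain ⟨hpp, hpq, hqp, hrp, hqq, hqr, hrr, hrq⟩ := h
  have k1 : p * (r * p) = 0 := by rw [hrp, hpp]
  let F : E → S := fun x => match x with
    | zero => 0
    | a => p
    | b => q
    | c => r
    | ac => p * r
  refine ⟨F, ⟨rfl, ?_, rfl, rfl, rfl⟩, ?_⟩
  · have e0 : F zero = 0 := rfl
    have ea : F a = p := rfl
    have eb : F b = q := rfl
    have ec : F c = r := rfl
    have ed : F ac = p * r := rfl
    have key : ∀ x y, F (mul x y) = F x * F y := by
      intro x y
      cases x <;> cases y <;> simp only [mul, e0, ea, eb, ec, ed] <;>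
        simp [hpp, hpq, hqp, hrp, hqq, hqr, hrr, hrq, mul_assoc,
          ← mul_assoc p p, ← mul_assoc q p, ← mul_assoc r p]
    exact key
  · rintro g ⟨h0, hm, ha, hb, hc⟩
    funext x
    cases x
    · exact h0
    · exact ha
    · exact hb
    · exact hc
    · change g (a * c) = p * r
      rw [hm, ha, hc]

end E

/-- The variety generated by the six-element monoid `E¹`, which is `E` with a new identity
element adjoined. -/
def varE : Set MonCat.{u} := generated {MonCat.of (ULift.{u} (WithOne E))}

/- The letters `x`, `y`, `z`, `t`, `s`. -/
def x : Word := FreeMonoid.of 0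
def y : Word := FreeMonoid.of 1
def z : Word := FreeMonoid.of 2
def t : Word := FreeMonoid.of 3
def s : Word := FreeMonoid.of 4

/-- The variety `var {x ≈ x², xyz ≈ xyxzxyz}` of idempotent monoids. -/
def varR3 : Set MonCat.{u} :=
  var {(x, x ^ 2), (x * y * z, x * y * x * z * x * y * z)}

/-- The identities `xtx ≈ xtx² ≈ x²tx`, `x²y² ≈ (xy)²`, `xyt²xsy ≈ xyxt²xsy`. -/
def basisXY : Set Identity :=
  {(x * t * x, x * t * x ^ 2), (x * t * x ^ 2, x ^ 2 * t * x),
    (x ^ 2 * y ^ 2, (x * y) ^ 2),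
    (x * y * t ^ 2 * x * s * y, x * y * x * t ^ 2 * x * s * y)}

/-- The identities `xtx ≈ xtx² ≈ x²tx`, `x²y² ≈ (xy)²`, `xyt²ysx ≈ xyxt²ysx`. -/
def basisYX : Set Identity :=
  {(x * t * x, x * t * x ^ 2), (x * t * x ^ 2, x ^ 2 * t * x),
    (x ^ 2 * y ^ 2, (x * y) ^ 2),
    (x * y * t ^ 2 * y * s * x, x * y * x * t ^ 2 * y * s * x)}

end MonoidVar

namespace MonoidVar

/-! ### Varieties and Birkhoff's theorem -/

/-! Each generator of the join forces an invariant on the two sides of its identities. In `E¹`,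
sending one letter to the nilpotent `a` and the others to `1` detects whether it occurs exactly
once. Since `b`, `c` form a left zero band and `a`, `ab = 0`, `ac` are distinct, the dual of `E¹`
reads off the order of last occurrences, both in the whole word and before each letter that occurs
once. The variety `varR3` contains a quotient of the free monoid that remembers the order of first
occurrences after the last occurrence of each letter. These invariants form `Balanced`.

Conversely, either basis implies `InsertionLaws`, and these imply every balanced identity. A
repeated letter may be squared, hence taken idempotent, and the letters that occur once cut the
words into blocks of idempotents. Inside a block, an occurrence of a letter that occurs both earlier
and later in the block can be deleted if every letter before it in the block recurs later. The
obstruction comes from dead letters, those that do not recur after the block; cutting at the last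
occurrence of a dead letter gives a recursion that uses exactly the invariants
(`InsertionLaws.val_eq_of_idem`).

Birkhoff's theorem turns this deduction into membership in the join. For the other inclusion, the
bases are checked exhaustively in `E¹` and its dual, and by a band computation in `varR3`. -/

theorem Satisfies.of_injective {M N : Type*} [Monoid M] [Monoid N] {e : Identity}
    (h : Satisfies N e) (f : M →* N) (hf : Function.Injective f) : Satisfies M e :=
  fun φ => hf (h (f.comp φ))

theorem Satisfies.of_surjective {M N : Type*} [Monoid M] [Monoid N] {e : Identity}
    (h : Satisfies M e) (f : M →* N) (hf : Function.Surjective f) : Satisfies N e := by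
  intro φ
  choose g hg using hf
  have hφ : φ = f.comp (FreeMonoid.lift fun i => g (φ (FreeMonoid.of i))) := by
    ext i
    simp [hg]
  rw [hφ]
  exact congrArg f (h _)

theorem Satisfies.of_mulEquiv {M N : Type*} [Monoid M] [Monoid N] {e : Identity}
    (h : Satisfies N e) (f : M ≃* N) : Satisfies M e :=
  h.of_injective f.toMonoidHom f.injective

theorem Satisfies.pi {ι : Type*} {M : ι → Type*} [∀ i, Monoid (M i)] {e : Identity}
    (h : ∀ i, Satisfies (M i) e) : Satisfies (∀ i, M i) e :=
  fun φ => funext fun i => h i ((Pi.evalMonoidHom M i).comp φ)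

theorem isVariety_var (I : Set Identity) : IsVariety (var.{u} I) where
  image _ hM _ f hf e he := (hM e he).of_surjective f hf
  submonoid _ hM S e he := (hM e he).of_injective S.subtype Subtype.val_injective
  pi _ _ hM e he := Satisfies.pi fun i => hM i e he

/-- The monoids whose opposites satisfy a set of identities form a variety. -/
theorem isVariety_op_var (I : Set Identity) :
    IsVariety {M : MonCat.{u} | ∀ e ∈ I, Satisfies (M : Type u)ᵐᵒᵖ e} where
  image _ hM _ f hf e he := (hM e he).of_surjective (MonoidHom.op f)
    fun y => by
      obtain ⟨a, ha⟩ := hf y.unop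
      exact ⟨MulOpposite.op a, congrArg MulOpposite.op ha⟩
  submonoid _ hM S e he := (hM e he).of_injective (MonoidHom.op S.subtype)
    fun a b hab => MulOpposite.unop_injective
      (Subtype.val_injective (congrArg MulOpposite.unop hab))
  pi ι M hM e he φ := by
    refine MulOpposite.unop_injective (funext fun i => ?_)
    exact congrArg MulOpposite.unop
      (hM i e he ((MonoidHom.op (Pi.evalMonoidHom (fun i => (M i : Type u)) i)).comp φ))

theorem isVariety_generated (K : Set MonCat.{u}) : IsVariety (generated K) where
  image M hM N f hf V hV := hV.1.image M (hM V hV) N f hf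
  submonoid M hM S V hV := hV.1.submonoid M (hM V hV) S
  pi ι M hM V hV := hV.1.pi ι M fun i => hM i V hV

theorem subset_generated (K : Set MonCat.{u}) : K ⊆ generated K :=
  fun _ hM _ hV => hV.2 hM

theorem generated_subset {K V : Set MonCat.{u}} (hV : IsVariety V) (h : K ⊆ V) :
    generated K ⊆ V :=
  fun _ hM => hM V ⟨hV, h⟩

/-- Birkhoff's theorem: a monoid that satisfies every identity of a variety belongs to it. -/
theorem IsVariety.mem_of_satisfies {V : Set MonCat.{u}} (hV : IsVariety V) (M : MonCat.{u})
    (hM : ∀ e : Identity, (∀ N ∈ V, Satisfies N e) → Satisfies M e) : M ∈ V := by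
  classical
  let F := FreeMonoid M
  -- Indexing by separated pairs of words, rather than by members of `V`, keeps the product indexed
  -- by a type in universe `u`.
  let ι := {p : F × F // ∃ N ∈ V, ∃ φ : F →* N, φ p.1 ≠ φ p.2}
  choose N hN φ hφ using fun p : ι => p.2
  let h : F →* (∀ i, N i) := MonoidHom.pi φ
  let ev : F →* M := FreeMonoid.lift id
  have key : Con.ker h ≤ Con.ker ev := by
    intro a b hab
    rw [Con.ker_rel] at hab ⊢
    have hsep : ∀ N ∈ V, ∀ φ : F →* N, φ a = φ b := by
      by_contra! hc
      exact hφ ⟨(a, b), hc⟩ (congrFun hab _)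
    -- Identities use the alphabet `ℕ`, so the finitely many letters of `a` and `b` are coded by
    -- their positions in `l`; the default `1` is never read.
    let l : List M := a.toList ++ b.toList
    let c : M → ℕ := fun m => l.idxOf m
    have hc : ∀ m ∈ l, l.getD (c m) 1 = m := fun m hm => by
      rw [List.getD_eq_getElem _ _ (List.idxOf_lt_length_of_mem hm)]
      simp
    have := hM (FreeMonoid.map c a, FreeMonoid.map c b)
      (fun N hN ψ => hsep N hN (ψ.comp (FreeMonoid.map c)))
      (FreeMonoid.lift fun n => l.getD n 1)
    have hev : ∀ w : F, (∀ m ∈ w.toList, m ∈ l) →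
        FreeMonoid.lift (fun n => l.getD n 1) (FreeMonoid.map c w) = ev w := by
      intro w hw
      rw [FreeMonoid.lift_apply, FreeMonoid.toList_map, List.map_map,
        show ev w = (w.toList.map id).prod from FreeMonoid.lift_apply _ _]
      exact congrArg List.prod (List.map_congr_left fun m hm => hc m (hw m hm))
    rwa [hev a fun m hm => List.mem_append_left _ hm,
      hev b fun m hm => List.mem_append_right _ hm] at this
  refine hV.image _ (hV.submonoid _ (hV.pi ι N hN) (MonoidHom.mrange h)) M
    ((Con.lift (Con.ker h) ev key).comp (Con.quotientKerEquivRange h).symm.toMonoidHom) ?_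
  intro m
  obtain ⟨s, hs⟩ := (Con.quotientKerEquivRange h).symm.surjective
    ((FreeMonoid.of m : F) : (Con.ker h).Quotient)
  refine ⟨s, ?_⟩
  change Con.lift (Con.ker h) ev key ((Con.quotientKerEquivRange h).symm s) = m
  rw [hs]
  exact FreeMonoid.lift_eval_of _ _

/-! ### First and last occurrences in words -/

/-- The letters of a word in the order of their first occurrences. -/
def ini : List ℕ → List ℕ
  | [] => []
  | a :: w => a :: (ini w).filter (· ≠ a)

/-- The part of a word after the last occurrence of a letter, or the word itself if the letter
does not occur. -/
def aft (a : ℕ) (w : List ℕ) : List ℕ := w.rtakeWhile (· ≠ a)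

theorem mem_ini {a : ℕ} {w : List ℕ} : a ∈ ini w ↔ a ∈ w := by
  induction w with
  | nil => simp [ini]
  | cons b w ih =>
    simp only [ini, List.mem_cons, List.mem_filter, ih]
    by_cases h : a = b <;> simp [h]

theorem nodup_ini (w : List ℕ) : (ini w).Nodup := by
  induction w with
  | nil => simp [ini]
  | cons b w ih => simp [ini, ih.filter]

theorem ini_append (p q : List ℕ) : ini (p ++ q) = ini p ++ (ini q).filter (· ∉ p) := by
  induction p with
  | nil => simp [ini]
  | cons a p ih =>
    simp only [List.cons_append, ini, ih, List.filter_append, List.filter_filter]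
    congr 2
    refine List.filter_congr fun x _ => ?_
    by_cases hx : x = a <;> simp [hx]

theorem ini_append_congr {p p' q q' : List ℕ} (hp : ini p = ini p') (hq : ini q = ini q') :
    ini (p ++ q) = ini (p' ++ q') := by
  rw [ini_append, ini_append, hp, hq]
  congr 1
  refine List.filter_congr fun x _ => ?_
  have hx : x ∈ p ↔ x ∈ p' := by rw [← mem_ini, hp, mem_ini]
  simp [hx]

theorem ini_append_of_subset {p q : List ℕ} (h : q ⊆ p) : ini (p ++ q) = ini p := by
  rw [ini_append, List.filter_eq_nil_iff.2, List.append_nil]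
  intro a ha
  simpa using h (mem_ini.1 ha)

/-- `List.dedup` keeps the last occurrence of each letter, so it serves as the mirror image of
`ini`. -/
theorem ini_reverse (w : List ℕ) : ini w.reverse = w.dedup.reverse := by
  induction w with
  | nil => simp [ini]
  | cons a w ih =>
    rw [List.reverse_cons, ini_append, ih]
    by_cases h : a ∈ w <;> simp [h, ini]

theorem dedup_append_eq (p q : List ℕ) :
    (p ++ q).dedup = p.dedup.filter (· ∉ q) ++ q.dedup := by
  induction p with
  | nil => simp
  | cons a p ih =>
    by_cases h : a ∈ p
    · simp [h, ih]
    · by_cases h' : a ∈ q <;> simp [h, h', ih]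

theorem aft_append_of_mem {a : ℕ} {q : List ℕ} (h : a ∈ q) (p : List ℕ) :
    aft a (p ++ q) = aft a q := by
  induction q using List.reverseRecOn with
  | nil => simp at h
  | append_singleton q b ih =>
    rw [aft, aft, ← List.append_assoc, List.rtakeWhile_concat, List.rtakeWhile_concat]
    by_cases hb : b = a
    · simp [hb]
    · have hq : a ∈ q := by
        simpa [Ne.symm hb] using h
      have := ih hq
      simp only [aft] at this
      rw [this]

theorem aft_append_of_notMem {a : ℕ} {q : List ℕ} (h : a ∉ q) (p : List ℕ) :
    aft a (p ++ q) = aft a p ++ q := by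
  induction q using List.reverseRecOn with
  | nil => simp
  | append_singleton q b ih =>
    simp only [List.mem_append, List.mem_singleton, not_or] at h
    have := ih h.1
    rw [aft] at this
    rw [aft, ← List.append_assoc, List.rtakeWhile_concat, this]
    simp [Ne.symm h.2]

theorem aft_of_notMem {a : ℕ} {q : List ℕ} (h : a ∉ q) : aft a q = q := by
  simpa [aft] using aft_append_of_notMem h []

theorem aft_append_cons {a : ℕ} {q : List ℕ} (h : a ∉ q) (p : List ℕ) :
    aft a (p ++ a :: q) = q := by
  rw [show p ++ a :: q = (p ++ [a]) ++ q by simp, aft_append_of_notMem h, aft,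
    List.rtakeWhile_concat]
  simp

theorem takeWhile_append_cons {a : ℕ} {p : List ℕ} (h : a ∉ p) (q : List ℕ) :
    (p ++ a :: q).takeWhile (· ≠ a) = p := by
  rw [List.takeWhile_append_of_pos (by
    intro x hx
    simpa using fun h' : x = a => h (h' ▸ hx))]
  simp

/-- A splitting of a word at a letter that occurs once is unique. -/
theorem append_cons_inj_of_notMem {a : ℕ} {p q p' q' : List ℕ} (hp : a ∉ p) (hp' : a ∉ p')
    (h : p ++ a :: q = p' ++ a :: q') : p = p' ∧ q = q' := by
  have h1 := congrArg (List.takeWhile (· ≠ a)) h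
  rw [takeWhile_append_cons hp, takeWhile_append_cons hp'] at h1
  subst h1
  simpa using h

/-- As `a` is absent from the prefix, it survives in `ini` directly after `ini p` and marks the cut.
In `dedup_split` the mirror argument applies, except that letters of the prefix survive only if they
do not recur. -/
theorem ini_split {a : ℕ} {p p' : List ℕ} (hp : a ∉ p) (hp' : a ∉ p') {q q' : List ℕ}
    (h : ini (p ++ a :: q) = ini (p' ++ a :: q')) : ini p = ini p' := by
  rw [ini_append, ini_append, ini, ini, List.filter_cons_of_pos (by simpa using hp),
    List.filter_cons_of_pos (by simpa using hp')] at h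
  exact (append_cons_inj_of_notMem (by rwa [mem_ini]) (by rwa [mem_ini]) h).1

theorem dedup_split {a : ℕ} {q q' : List ℕ} (hq : a ∉ q) (hq' : a ∉ q') {p p' : List ℕ}
    (h : (p ++ a :: q).dedup = (p' ++ a :: q').dedup) :
    p.dedup.filter (· ∉ a :: q) = p'.dedup.filter (· ∉ a :: q') ∧ q.dedup = q'.dedup := by
  rw [dedup_append_eq, dedup_append_eq, List.dedup_cons_of_notMem hq,
    List.dedup_cons_of_notMem hq'] at h
  exact append_cons_inj_of_notMem (by simp) (by simp) h

/-- A repetition-free word is determined by the first letters of its restrictions to two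
letters. -/
theorem eq_of_find?_eq {l l' : List ℕ} (hl : l.Nodup) (hl' : l'.Nodup)
    (h : ∀ y z, l.find? (fun a => a = y ∨ a = z) = l'.find? (fun a => a = y ∨ a = z)) :
    l = l' := by
  induction l generalizing l' with
  | nil =>
    cases l' with
    | nil => rfl
    | cons b m => simpa using h b b
  | cons a l ih =>
    cases l' with
    | nil => simpa using h a a
    | cons b m =>
      have hab : a = b := by simpa using h a b
      subst hab
      rw [List.nodup_cons] at hl hl'
      congr 1
      refine ih hl.2 hl'.2 fun y z => ?_
      have aux : ∀ y z, y ≠ a → z ≠ a → l.find? (fun a => a = y ∨ a = z) =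
          m.find? (fun a => a = y ∨ a = z) := fun y z hy hz => by
        simpa [hy.symm, hz.symm] using h y z
      have cong : ∀ {k : List ℕ} {p q : ℕ → Bool}, (∀ x ∈ k, p x = q x) →
          k.find? p = k.find? q := by
        intro k p q hpq
        induction k with
        | nil => rfl
        | cons c k ih =>
          rw [List.find?_cons, List.find?_cons, hpq c (by simp),
            ih fun x hx => hpq x (by simp [hx])]
      have drop : ∀ {k : List ℕ} (y), a ∉ k → k.find? (fun x => x = a ∨ x = y) =
          k.find? (fun x => x = y ∨ x = y) := fun y hk => cong fun x hx => by
        have : x ≠ a := fun h => hk (h ▸ hx)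
        simp [this]
      have drop' : ∀ {k : List ℕ} (y), a ∉ k → k.find? (fun x => x = y ∨ x = a) =
          k.find? (fun x => x = y ∨ x = y) := fun y hk => cong fun x hx => by
        have : x ≠ a := fun h => hk (h ▸ hx)
        simp [this]
      have none : ∀ {k : List ℕ}, a ∉ k → k.find? (fun x => x = a ∨ x = a) = none := by
        intro k hk
        simp only [or_self, List.find?_eq_none, decide_eq_true_eq]
        exact fun x hx h => hk (h ▸ hx)
      -- A query that involves the removed head `a` says nothing about the tails; but `a` is absent
      -- from them, so it reduces to a query for the other letter alone.
      by_cases hy : y = a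
      · subst hy
        rw [drop z hl.1, drop z hl'.1]
        by_cases hz : z = y
        · subst hz
          rw [none hl.1, none hl'.1]
        · exact aux z z hz hz
      · by_cases hz : z = a
        · subst hz
          rw [drop' y hl.1, drop' y hl'.1]
          exact aux y y hy hy
        · exact aux y z hy hz

theorem find?_ini (w : List ℕ) (p : ℕ → Bool) : (ini w).find? p = w.find? p := by
  induction w with
  | nil => rfl
  | cons a w ih =>
    rw [ini, List.find?_cons, List.find?_cons]
    by_cases ha : p a
    · simp [ha]
    · simp only [ha, List.find?_filter, ← ih]
      congr 1
      funext x
      by_cases hx : x = a <;> simp [hx, ha]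

theorem ini_eq_of_find?_eq {w w' : List ℕ}
    (h : ∀ y z, w.find? (fun a => a = y ∨ a = z) = w'.find? (fun a => a = y ∨ a = z)) :
    ini w = ini w' :=
  eq_of_find?_eq (nodup_ini w) (nodup_ini w') fun y z => by rw [find?_ini, find?_ini, h]

/-! ### Evaluation of words under the insertion laws -/

section Evaluation

variable {M : Type u} [Monoid M]

/-- The value of a word under an assignment of elements of a monoid to the letters. -/
def val (g : ℕ → M) (w : List ℕ) : M := (w.map g).prod

@[simp] theorem val_nil (g : ℕ → M) : val g [] = 1 := rfl

@[simp] theorem val_cons (g : ℕ → M) (a : ℕ) (w : List ℕ) :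
    val g (a :: w) = g a * val g w := by simp [val]

@[simp] theorem val_append (g : ℕ → M) (p q : List ℕ) :
    val g (p ++ q) = val g p * val g q := by simp [val]

theorem val_congr {f g : ℕ → M} {w : List ℕ} (h : ∀ a ∈ w, f a = g a) : val f w = val g w :=
  congrArg List.prod (List.map_congr_left h)

/-- The consequences of the identities `basisXY` or `basisYX` from which all identities of the
join are deduced. -/
structure InsertionLaws (M : Type u) [Monoid M] : Prop where
  right_sq : ∀ x t : M, x * t * x = x * t * (x * x)
  left_sq : ∀ x t : M, x * t * x = x * x * t * x
  idem_mul : ∀ {a b : M}, IsIdempotentElem a → IsIdempotentElem b → IsIdempotentElem (a * b)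
  insert_near : ∀ {a b e : M}, IsIdempotentElem a → IsIdempotentElem b → IsIdempotentElem e →
    ∀ s, a * b * e * a * s * b = a * b * a * e * a * s * b
  insert_far : ∀ {a b e : M}, IsIdempotentElem a → IsIdempotentElem b → IsIdempotentElem e →
    ∀ s, a * b * e * b * s * a = a * b * a * e * b * s * a

namespace InsertionLaws

theorem idem_sq (hM : InsertionLaws M) (a : M) : IsIdempotentElem (a * a) := by
  have h : a * a = a * (a * a) := by simpa using hM.right_sq a 1
  rw [IsIdempotentElem, mul_assoc, ← h, ← h]

theorem idem_val (hM : InsertionLaws M) {g : ℕ → M} (hg : ∀ a, IsIdempotentElem (g a))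
    (w : List ℕ) : IsIdempotentElem (val g w) := by
  induction w with
  | nil => exact IsIdempotentElem.one
  | cons a w ih => rw [val_cons]; exact hM.idem_mul (hg a) ih

theorem insert_one (hM : InsertionLaws M) {g : ℕ → M} (hg : ∀ a, IsIdempotentElem (g a))
    {x b : ℕ} {p : List ℕ} {r : M} (hx : x ∈ p) (hb : b ∈ p ∨ ∃ s s', r = s * g b * s') :
    val g (x :: b :: p) * r = val g (x :: b :: x :: p) * r := by
  obtain ⟨A, C, rfl⟩ := List.append_of_mem hx
  have hA := hM.idem_val hg
  rcases hb with hb | ⟨s, s', rfl⟩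
  · rw [List.mem_append, List.mem_cons] at hb
    rcases hb with hb | rfl | hb
    · obtain ⟨A₁, A₂, rfl⟩ := List.append_of_mem hb
      have := congrArg (· * (val g C * r))
        (hM.insert_far (hg x) (hg b) (hA A₁) (val g A₂))
      simpa [mul_assoc] using this
    · have h : g b * g b = g b := hg b
      simp [← mul_assoc, h]
    · obtain ⟨C₁, C₂, rfl⟩ := List.append_of_mem hb
      have := congrArg (· * (val g C₂ * r))
        (hM.insert_near (hg x) (hg b) (hA A) (val g C₁))
      simpa [mul_assoc] using this
  · have := congrArg (· * s') (hM.insert_near (hg x) (hg b) (hA A) (val g C * s))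
    simpa [mul_assoc] using this

variable {g : ℕ → M} {L : ℕ → Prop} {r : M}

/-- `x` is inserted after the first letter of `w`, carried through the rest by induction, and the
auxiliary copy is then removed. The predicate `L` marks live letters, those whose value is a factor
of the context `r`. -/
theorem insert_after (hM : InsertionLaws M) (hg : ∀ a, IsIdempotentElem (g a))
    (hL : ∀ b, L b → ∃ s s', r = s * g b * s') {x : ℕ} {p : List ℕ} (hx : x ∈ p)
    {w : List ℕ} (hw : ∀ b ∈ w, b ∈ p ∨ L b) :
    val g (x :: (w ++ p)) * r = val g (x :: (w ++ x :: p)) * r := by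
  induction w with
  | nil =>
    have h : g x * g x = g x := hg x
    simp [← mul_assoc, h]
  | cons b w ih =>
    have hb : ∀ {q : List ℕ}, p ⊆ q → (b ∈ q ∨ ∃ s s', r = s * g b * s') := fun hq =>
      (hw b (by simp)).imp (fun h => hq h) (hL b)
    have e := ih fun c hc => hw c (by simp [hc])
    have h : ∀ q, val g (x :: b :: x :: q) * r = g x * (g b * (val g (x :: q) * r)) := by
      simp [mul_assoc]
    rw [List.cons_append, hM.insert_one hg (by simp [hx]) (hb (by simp)), List.cons_append,
      hM.insert_one (p := w ++ x :: p) hg (by simp) (hb fun _ _ => by simp [*]), h, h, e]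

theorem erase_repeated (hM : InsertionLaws M) (hg : ∀ a, IsIdempotentElem (g a))
    (hL : ∀ b, L b → ∃ s s', r = s * g b * s') {x : ℕ} {p w : List ℕ} (hx : x ∈ p)
    (hxw : x ∈ w) (hw : ∀ b ∈ w, b ∈ p ∨ L b) :
    val g (w ++ x :: p) * r = val g (w ++ p) * r := by
  obtain ⟨A, C, rfl⟩ := List.append_of_mem hxw
  have := hM.insert_after hg hL hx (w := C) fun b hb => hw b (by simp [hb])
  simp only [List.append_assoc, List.cons_append, val_append g A, mul_assoc]
  rw [← this]

theorem val_eq_ini (hM : InsertionLaws M) (hg : ∀ a, IsIdempotentElem (g a))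
    (hL : ∀ b, L b → ∃ s s', r = s * g b * s') {p w : List ℕ} (hw : w ⊆ p) :
    ∀ u : List ℕ, u ⊆ p →
      val g (u ++ (w ++ p)) * r = val g (u ++ ((ini w).filter (· ∉ u) ++ p)) * r := by
  induction w with
  | nil => simp [ini]
  | cons a w ih =>
    intro u hu
    have hw' : w ⊆ p := fun b hb => hw (by simp [hb])
    have ha : a ∈ p := hw (by simp)
    by_cases h : a ∈ u
    · rw [List.cons_append, hM.erase_repeated hg hL (by simp [ha]) h
        (fun b hb => Or.inl (by simp [hu hb])), ih hw' u hu, ini,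
        List.filter_cons_of_neg (by simpa using h), List.filter_filter]
      have e : (ini w).filter (fun b => decide (b ∉ u) && decide (b ≠ a)) =
          (ini w).filter (· ∉ u) := List.filter_congr fun x _ => by
        by_cases hx : x = a <;> simp [hx, h]
      rw [e]
    · have := ih hw' (u ++ [a]) (by simp [hu, ha])
      rw [List.cons_append, ini, List.filter_cons_of_pos (by simpa using h), List.filter_filter]
      have e : (ini w).filter (fun b => decide (b ∉ u) && decide (b ≠ a)) =
          (ini w).filter (· ∉ u ++ [a]) := List.filter_congr fun x _ => by simp
      rw [e]
      simpa using this

/-- Every letter of `w` already occurs in `u`, so any occurrence in `w` that recurs in the rest of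
`w` or in `p` can be erased. Recurrence in `r` alone does not allow this, so last occurrences of
live letters remain. -/
theorem val_eq_dedup (hM : InsertionLaws M) (hg : ∀ a, IsIdempotentElem (g a))
    (hL : ∀ b, L b → ∃ s s', r = s * g b * s') {p w : List ℕ} :
    ∀ u : List ℕ, w ⊆ u → (∀ b ∈ u, b ∈ p ∨ L b) →
      val g (u ++ (w ++ p)) * r = val g (u ++ (w.dedup.filter (· ∉ p) ++ p)) * r := by
  induction w with
  | nil => simp
  | cons a w ih =>
    intro u hwu hu
    have hw' : w ⊆ u := fun b hb => hwu (by simp [hb])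
    have ha : a ∈ u := hwu (by simp)
    by_cases h : a ∈ w ++ p
    · rw [List.cons_append, hM.erase_repeated hg hL h ha
        (fun b hb => (hu b hb).imp_left fun h => by simp [h]), ih u hw' hu]
      by_cases h' : a ∈ w
      · rw [List.dedup_cons_of_mem h']
      · rw [List.dedup_cons_of_notMem h',
          List.filter_cons_of_neg (by simpa [h'] using h)]
    · have h₁ : a ∉ w := fun h' => h (by simp [h'])
      have h₂ : a ∉ p := fun h' => h (by simp [h'])
      have := ih (u ++ [a]) (fun b hb => by simp [hw' hb]) (by
        intro b hb
        rw [List.mem_append, List.mem_singleton] at hb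
        exact hb.elim (hu b) fun h => h ▸ hu a ha)
      rw [List.dedup_cons_of_notMem h₁, List.filter_cons_of_pos (by simpa using h₂)]
      simpa using this

end InsertionLaws

/-- The cut is at the leftmost among the last occurrences of dead letters, so that every letter
before it recurs or is live, as the erasing lemmas require. -/
theorem exists_first_dead {L : ℕ → Prop} {p : List ℕ} (h : ∃ d ∈ p, ¬ L d) :
    ∃ w d q, p = w ++ d :: q ∧ ¬ L d ∧ d ∉ q ∧ ∀ b ∈ w, b ∈ d :: q ∨ L b := by
  induction p with
  | nil => simp at h
  | cons a p ih =>
    by_cases hp : ∃ d ∈ p, ¬ L d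
    · obtain ⟨w, d, q, rfl, hd, hdq, hw⟩ := ih hp
      by_cases ha : a ∈ d :: q ∨ L a
      · exact ⟨a :: w, d, q, rfl, hd, hdq, by
          intro b hb
          rcases List.mem_cons.1 hb with rfl | hb
          exacts [ha, hw b hb]⟩
      · rw [not_or] at ha
        refine ⟨[], a, _, rfl, ha.2, fun h => ?_, by simp⟩
        rcases List.mem_append.1 h with h | h
        · exact (not_or.2 ha) (hw a h)
        · exact ha.1 h
    · push Not at hp
      obtain ⟨d, hd, hLd⟩ := h
      rcases List.mem_cons.1 hd with rfl | hd
      · exact ⟨[], d, p, rfl, hLd, fun h => hLd (hp d h), by simp⟩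
      · exact absurd (hp d hd) hLd

/-- Two words over letters with idempotent values agree in a right context if they have the same
first and last occurrences, and the same first occurrences after every letter that does not
occur in the context. -/
theorem InsertionLaws.val_eq_of_idem (hM : InsertionLaws M) {g : ℕ → M}
    (hg : ∀ a, IsIdempotentElem (g a)) {L : ℕ → Prop} {r : M}
    (hL : ∀ b, L b → ∃ s s', r = s * g b * s') {p q : List ℕ} (hd : p.dedup = q.dedup)
    (hi : ini p = ini q) (ha : ∀ d, ¬ L d → ini (aft d p) = ini (aft d q)) :
    val g p * r = val g q * r := by
  -- The value of `p` is idempotent; in `pp` every letter of the first copy recurs, so that copy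
  -- shrinks to `ini p`.
  have dbl : ∀ p : List ℕ, val g p * r = val g (ini p ++ p) * r := fun p => by
    have := hM.val_eq_ini hg hL (List.Subset.refl p) [] (by simp)
    have h : val g p * val g p = val g p := hM.idem_val hg p
    simpa [h] using this
  have mem : ∀ a, a ∈ p ↔ a ∈ q := fun a => by rw [← mem_ini, hi, mem_ini]
  by_cases h : ∃ d ∈ p, ¬ L d
  · obtain ⟨w, d, p', hp, hLd, hdp, hw⟩ := exists_first_dead h
    obtain ⟨w', q', hq, hdq⟩ : ∃ w' q', q = w' ++ d :: q' ∧ d ∉ q' := by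
      have : d ∈ q := (mem d).1 (by simp [hp])
      obtain ⟨A, B, hAB, hA⟩ := List.eq_append_cons_of_mem (List.mem_reverse.2 this)
      refine ⟨B.reverse, A.reverse, ?_, by simpa using hA⟩
      simpa using congrArg List.reverse hAB
    rw [hp, hq] at hd
    obtain ⟨hF, hd'⟩ := dedup_split hdp hdq hd
    -- A letter of `w'` that does not recur appears in the part of `dedup` before `d`, which is the
    -- same for `w`; hence it is live.
    have hw' : ∀ b ∈ w', b ∈ d :: q' ∨ L b := by
      intro b hb
      by_cases hbq : b ∈ d :: q'
      · exact Or.inl hbq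
      · have : b ∈ w.dedup.filter (· ∉ d :: p') := by
          rw [hF, List.mem_filter]
          exact ⟨List.mem_dedup.2 hb, by simpa using hbq⟩
        rw [List.mem_filter, List.mem_dedup] at this
        exact Or.inr ((hw b this.1).resolve_left (by simpa using this.2))
    have hi' : ini p' = ini q' := by
      have := ha d hLd
      rwa [hp, hq, aft_append_cons hdp, aft_append_cons hdq] at this
    have ih : val g p' * r = val g q' * r := by
      refine hM.val_eq_of_idem hg hL hd' hi' fun x hx => ?_
      by_cases hxp : x ∈ p'
      · have hxq : x ∈ q' := by rwa [← mem_ini, ← hi', mem_ini]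
        have := ha x hx
        rw [hp, hq, List.append_cons, List.append_cons w'] at this
        rwa [aft_append_of_mem hxp, aft_append_of_mem hxq] at this
      · have hxq : x ∉ q' := by rwa [← mem_ini, ← hi', mem_ini]
        rwa [aft_of_notMem hxp, aft_of_notMem hxq]
    -- With `ini p` in front, `w` shrinks to the last occurrences of the letters absent from `d ::
    -- p'`, so only the tail `p'` is left to the recursion.
    have red : ∀ {p w : List ℕ} {p' : List ℕ}, p = w ++ d :: p' →
        (∀ b ∈ w, b ∈ d :: p' ∨ L b) →
        val g p * r = val g (ini p ++ w.dedup.filter (· ∉ d :: p')) * (g d * (val g p' * r)) := by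
      intro p w p' hp hw
      have := hM.val_eq_dedup hg hL (p := d :: p') (w := w) (ini p)
        (fun b hb => mem_ini.2 (by simp [hp, hb])) (by
          intro b hb
          rw [mem_ini, hp, List.mem_append] at hb
          exact hb.elim (hw b) Or.inl)
      rw [← hp] at this
      rw [dbl, this]
      simp [mul_assoc]
    rw [red hp hw, red hq hw', hi, hF, ih]
  · push Not at h
    have red : ∀ {p : List ℕ}, (∀ d ∈ p, L d) →
        val g p * r = val g (ini p ++ p.dedup) * r := by
      intro p hp
      have := hM.val_eq_dedup hg hL (p := []) (w := p) (ini p)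
        (fun b hb => mem_ini.2 hb) (fun b hb => Or.inr (hp b (mem_ini.1 hb)))
      rw [dbl]
      simpa using this
    rw [red h, red fun d hd => h d ((mem d).2 hd), hi, hd]
termination_by p.length
decreasing_by simp [hp]; omega

/-! ### Words cut at the letters that occur once -/

theorem exists_first {S : Set ℕ} {u : List ℕ} (h : ∃ t ∈ u, t ∈ S) :
    ∃ p t q, u = p ++ t :: q ∧ t ∈ S ∧ ∀ a ∈ p, a ∉ S := by
  induction u with
  | nil => simp at h
  | cons a u ih =>
    by_cases ha : a ∈ S
    · exact ⟨[], a, u, rfl, ha, by simp⟩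
    · obtain ⟨p, t, q, rfl, ht, hp⟩ := ih (by
        obtain ⟨t, ht, hS⟩ := h
        rcases List.mem_cons.1 ht with rfl | ht
        exacts [absurd hS ha, ⟨t, ht, hS⟩])
      exact ⟨a :: p, t, q, rfl, ht, by simpa [ha] using hp⟩

/-- For a letter absent from both words, `aft` returns the whole word. -/
theorem ini_eq_of_aft {u v : List ℕ} (h : ∀ a, ini (aft a u) = ini (aft a v)) :
    ini u = ini v := by
  obtain ⟨a, ha⟩ := Infinite.exists_notMem_finset (u ++ v).toFinset
  simp only [List.mem_toFinset, List.mem_append, not_or] at ha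
  simpa [aft_of_notMem ha.1, aft_of_notMem ha.2] using h a

/-- Words in which the letters of `S` occur at most once and the other letters have idempotent
values. -/
theorem InsertionLaws.val_eq (hM : InsertionLaws M) {S : Set ℕ} {f : ℕ → M}
    (hf : ∀ a, a ∉ S → IsIdempotentElem (f a)) {u v : List ℕ}
    (hu : ∀ t ∈ S, u.count t ≤ 1) (hv : ∀ t ∈ S, v.count t ≤ 1)
    (hd : u.dedup = v.dedup)
    (hb : ∀ t ∈ S, (u.takeWhile (· ≠ t)).dedup = (v.takeWhile (· ≠ t)).dedup)
    (ha : ∀ x, ini (aft x u) = ini (aft x v)) : val f u = val f v := by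
  classical
  have hi := ini_eq_of_aft ha
  have mem : ∀ a, a ∈ u ↔ a ∈ v := fun a => by rw [← mem_ini, hi, mem_ini]
  -- The block lemma needs idempotent values for all letters; those of `S` do not occur in the
  -- blocks, so `1` is harmless.
  let g : ℕ → M := fun a => if a ∈ S then 1 else f a
  have hg : ∀ a, IsIdempotentElem (g a) := fun a => by
    by_cases h : a ∈ S
    · simpa [g, h] using IsIdempotentElem.one
    · simpa [g, h] using hf a h
  have hgv : ∀ {w : List ℕ}, (∀ a ∈ w, a ∉ S) → val f w = val g w := fun hw =>
    val_congr fun a h => by simp [g, hw a h]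
  by_cases h : ∃ t ∈ u, t ∈ S
  · obtain ⟨p, t, u', hu', htS, hp⟩ := exists_first h
    obtain ⟨q, t', v', hv', ht'S, hq⟩ := exists_first
      (S := S) (u := v) (by obtain ⟨t, ht, hS⟩ := h; exact ⟨t, (mem t).1 ht, hS⟩)
    obtain rfl : t = t' := by
      have fst : ∀ {p u' : List ℕ} {t : ℕ}, t ∈ S → (∀ a ∈ p, a ∉ S) →
          (p ++ t :: u').find? (fun a => decide (a ∈ S)) = some t := by
        intro p u' t ht hp
        rw [List.find?_append, List.find?_eq_none.2 (by simpa using hp)]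
        simp [ht]
      have := fst (u' := u') htS hp
      rw [← hu', ← find?_ini, hi, find?_ini, hv', fst ht'S hq] at this
      exact (Option.some.inj this).symm
    have htp : t ∉ p := fun h => hp t h htS
    have htq : t ∉ q := fun h => hq t h htS
    have htu : t ∉ u' := by
      have := hu t htS
      rw [hu', List.count_append, List.count_cons_self] at this
      exact List.count_eq_zero.1 (by omega)
    have htv : t ∉ v' := by
      have := hv t htS
      rw [hv', List.count_append, List.count_cons_self] at this
      exact List.count_eq_zero.1 (by omega)
    have hi' : ini u' = ini v' := by
      have := ha t
      rwa [hu', hv', aft_append_cons htu, aft_append_cons htv] at this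
    have mem' : ∀ a, a ∈ u' ↔ a ∈ v' := fun a => by rw [← mem_ini, hi', mem_ini]
    have hd' : u'.dedup = v'.dedup := by
      rw [hu', hv'] at hd
      exact (dedup_split htu htv hd).2
    have tw : ∀ {p u' : List ℕ} {s : ℕ}, s ∈ S → s ≠ t → (∀ a ∈ p, a ∉ S) →
        (p ++ t :: u').takeWhile (· ≠ s) = p ++ t :: u'.takeWhile (· ≠ s) := by
      intro p u' s hs hst hp
      rw [List.takeWhile_append_of_pos (by
        intro x hx
        simpa using fun h' : x = s => hp x hx (h' ▸ hs)), List.takeWhile_cons_of_pos]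
      simpa using hst.symm
    have ih : val f u' = val f v' := by
      refine hM.val_eq (S := S) hf (fun s hs => ?_) (fun s hs => ?_) hd' (fun s hs => ?_)
        fun x => ?_
      · refine le_trans ?_ (hu s hs)
        rw [hu']
        exact List.Sublist.count_le _ (by simp)
      · refine le_trans ?_ (hv s hs)
        rw [hv']
        exact List.Sublist.count_le _ (by simp)
      · by_cases hst : s = t
        · subst hst
          rw [List.takeWhile_eq_self_iff.2, List.takeWhile_eq_self_iff.2, hd']
          · intro x hx
            simpa using fun h' : x = s => htv (h' ▸ hx)
          · intro x hx
            simpa using fun h' : x = s => htu (h' ▸ hx)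
        · have := hb s hs
          rw [hu', hv', tw hs hst hp, tw hs hst hq] at this
          exact (dedup_split (fun h => htu (List.takeWhile_subset _ h))
            (fun h => htv (List.takeWhile_subset _ h)) this).2
      · by_cases hx : x ∈ u'
        · have := ha x
          rwa [hu', hv', List.append_cons, List.append_cons q, aft_append_of_mem hx,
            aft_append_of_mem ((mem' x).1 hx)] at this
        · rw [aft_of_notMem hx, aft_of_notMem fun h => hx ((mem' x).2 h), hi']
    have hpq : ini p = ini q := by
      rw [hu', hv'] at hi
      exact ini_split htp htq hi
    have memp : ∀ a, a ∈ p ↔ a ∈ q := fun a => by rw [← mem_ini, hpq, mem_ini]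
    -- A dead letter of the block is absent from `u'`, so the part of `u` after its last occurrence
    -- begins inside the block, and cutting at `t` isolates the block's share.
    have blk : val g p * (f t * val f u') = val g q * (f t * val f u') := by
      refine hM.val_eq_of_idem hg (L := fun b => b ∈ u' ∧ b ∉ S) ?_ ?_ hpq ?_
      · rintro b ⟨hbu, hbS⟩
        obtain ⟨A, B, rfl⟩ := List.append_of_mem hbu
        exact ⟨f t * val f A, val f B, by simp [g, hbS, mul_assoc]⟩
      · have := hb t htS
        rwa [hu', hv', takeWhile_append_cons htp, takeWhile_append_cons htq] at this
      · intro d hLd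
        by_cases hdp : d ∈ p
        · have hdu : d ∉ u' := fun h => hLd ⟨h, hp d hdp⟩
          have hdt : d ≠ t := fun h => htp (h ▸ hdp)
          have := ha d
          have h₁ : d ∉ t :: u' := by simp [hdt, hdu]
          have h₂ : d ∉ t :: v' := by simp [hdt, ← mem', hdu]
          rw [hu', hv', aft_append_of_notMem h₁, aft_append_of_notMem h₂] at this
          refine ini_split (fun h => htp ?_) (fun h => htq ?_) this
          · exact (List.rtakeWhile_suffix _ _).subset h
          · exact (List.rtakeWhile_suffix _ _).subset h
        · rw [aft_of_notMem hdp, aft_of_notMem fun h => hdp ((memp d).2 h), hpq]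
    rw [hu', hv', val_append, val_append, val_cons, val_cons, hgv hp, hgv hq, blk, ih]
  · push Not at h
    have h' : ∀ a ∈ v, a ∉ S := fun a hav => h a ((mem a).2 hav)
    have := hM.val_eq_of_idem hg (L := fun _ => False) (r := 1) (by simp) hd hi
      fun d _ => ha d
    rw [hgv h, hgv h']
    simpa using this
termination_by u.length
decreasing_by simp [hu']; omega

/-- A letter that occurs at least twice may be replaced by its square. -/
theorem InsertionLaws.val_update (hM : InsertionLaws M) (f : ℕ → M) {x : ℕ} {w : List ℕ}
    (hx : 2 ≤ w.count x) : val f w = val (Function.update f x (f x * f x)) w := by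
  set f' := Function.update f x (f x * f x) with hf'
  have hne : ∀ a, a ≠ x → f' a = f a := fun a h => Function.update_of_ne h _ _
  have hxx : f' x = f x * f x := Function.update_self _ _ _
  -- An occurrence of `x` with another to its left is squared by `right_sq`; the first occurrence is
  -- squared by `left_sq`.
  have tail : ∀ (w : List ℕ) (m : M), f x * m * val f w = f x * m * val f' w := by
    intro w
    induction w with
    | nil => intro m; rfl
    | cons a w ih =>
      intro m
      by_cases h : a = x
      · subst h
        rw [val_cons, val_cons, hxx, ← mul_assoc, hM.right_sq, mul_assoc (f a) m, ih]
        simp only [mul_assoc]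
      · rw [val_cons, val_cons, hne a h, ← mul_assoc, mul_assoc (f x), ih]
        simp only [mul_assoc]
  have hmem : x ∈ w := List.count_pos_iff.1 (by omega)
  obtain ⟨p, q, rfl, hp⟩ := List.eq_append_cons_of_mem hmem
  have hq : x ∈ q := by
    rw [List.count_append, List.count_cons_self, List.count_eq_zero.2 hp] at hx
    exact List.count_pos_iff.1 (by omega)
  have hpv : val f p = val f' p := val_congr fun a ha => (hne a fun h => hp (h ▸ ha)).symm
  have e₁ : f x * val f q = f x * f x * val f q := by
    obtain ⟨A, B, rfl⟩ := List.append_of_mem hq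
    have := congrArg (· * val f B) (hM.left_sq (f x) (val f A))
    simpa [mul_assoc] using this
  rw [val_append, val_append, val_cons, val_cons, ← hpv, hxx, e₁, tail q (f x)]

theorem InsertionLaws.val_sq (hM : InsertionLaws M) (f : ℕ → M) {w : List ℕ} {D : Finset ℕ}
    (hD : ∀ x ∈ D, 2 ≤ w.count x) :
    val f w = val (fun a => if a ∈ D then f a * f a else f a) w := by
  induction D using Finset.induction_on with
  | empty => simp
  | insert x D hx ih =>
    rw [ih fun y hy => hD y (by simp [hy]), hM.val_update _ (hD x (by simp))]
    refine val_congr fun a _ => ?_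
    by_cases h : a = x
    · subst h; simp [hx]
    · simp [h]

/-- Invariants of an identity that make it a consequence of the insertion laws. -/
structure Balanced (u v : List ℕ) : Prop where
  count : ∀ t, u.count t = 1 ↔ v.count t = 1
  dedup : u.dedup = v.dedup
  before : ∀ t, u.count t = 1 → (u.takeWhile (· ≠ t)).dedup = (v.takeWhile (· ≠ t)).dedup
  after : ∀ x, ini (aft x u) = ini (aft x v)

theorem InsertionLaws.val_eq_of_balanced (hM : InsertionLaws M) {u v : List ℕ}
    (h : Balanced u v) (f : ℕ → M) : val f u = val f v := by
  have mem : ∀ a, a ∈ u ↔ a ∈ v := fun a => by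
    rw [← List.mem_dedup, h.dedup, List.mem_dedup]
  -- `F` depends on `u` alone, yet suits both words because they have the same letters of
  -- multiplicity one.
  let F : ℕ → M := fun a => if u.count a = 1 then f a else f a * f a
  have key : ∀ {w : List ℕ}, (∀ t, u.count t = 1 ↔ w.count t = 1) → val f w = val F w := by
    intro w hw
    rw [hM.val_sq f (D := w.toFinset.filter fun a => 2 ≤ w.count a) (by simp)]
    refine val_congr fun a ha => ?_
    have h1 : 1 ≤ w.count a := List.count_pos_iff.2 ha
    by_cases h2 : w.count a = 1
    · simp [F, hw, h2]
    · have : 2 ≤ w.count a := by omega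
      simp [F, hw, h2, this, ha]
  rw [key fun _ => Iff.rfl, key h.count]
  refine hM.val_eq (S := {t | u.count t = 1}) (fun a ha => ?_) (fun t ht => le_of_eq ht)
    (fun t ht => ((h.count t).1 ht).le) h.dedup h.before h.after
  have : u.count a ≠ 1 := ha
  simpa [F, this] using hM.idem_sq (f a)

end Evaluation

/-! ### Invariants of the generators -/

theorem lift_eq_val {M : Type*} [Monoid M] (g : ℕ → M) (w : Word) :
    FreeMonoid.lift g w = val g w.toList := FreeMonoid.lift_apply _ _

/-- The assignment `t ↦ a`, `y ↦ b`, `z ↦ c` of elements of `E¹`. -/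
def assign (t y z i : ℕ) : WithOne E :=
  if i = t then E.a else if i = y then E.b else if i = z then E.c else 1

/-- The element of `E¹` that records the letter found. -/
def code (y : ℕ) : Option ℕ → WithOne E
  | none => 1
  | some i => if i = y then E.b else E.c

theorem b_mul_code (y : ℕ) (o : Option ℕ) : (E.b : WithOne E) * code y o = E.b := by
  cases o with
  | none => rfl
  | some i => by_cases h : i = y <;> simp [code, h] <;> rfl

theorem c_mul_code (y : ℕ) (o : Option ℕ) : (E.c : WithOne E) * code y o = E.c := by
  cases o with
  | none => rfl
  | some i => by_cases h : i = y <;> simp [code, h] <;> rfl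

/-- Products of `b`s and `c`s equal their first factor, so the value records which of `y`, `z` comes
first. -/
theorem val_assign {t : ℕ} (y z : ℕ) {w : List ℕ} (h : t ∉ w) :
    val (assign t y z) w = code y (w.find? fun a => a = y ∨ a = z) := by
  induction w with
  | nil => rfl
  | cons i w ih =>
    rw [List.mem_cons, not_or] at h
    rw [val_cons, ih h.2, List.find?_cons]
    by_cases hy : i = y
    · subst hy
      rw [show assign t i z i = E.b by simp [assign, Ne.symm h.1], b_mul_code]
      simp [code]
    · by_cases hz : i = z
      · subst hz
        rw [show assign t y i i = E.c by simp [assign, Ne.symm h.1, hy], c_mul_code,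
          decide_eq_true (Or.inr rfl : i = y ∨ i = i)]
        exact (if_neg hy).symm
      · simp [assign, Ne.symm h.1, hy, hz]

theorem code_mul_a_mul_code (y : ℕ) (o o' : Option ℕ) :
    code y o * ((E.a : WithOne E) * code y o') = E.a * code y o' := by
  cases o with
  | none => simp [code]
  | some i =>
    rw [← mul_assoc]
    by_cases h : i = y <;> simp only [code, h, if_true, if_false] <;> rfl

/-- The products `a`, `ab = 0` and `ac` are distinct, so the code to the right of `a` can be
recovered; a code to its left is absorbed. -/
theorem a_mul_code_injective {y : ℕ} {o o' : Option ℕ}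
    (h : (E.a : WithOne E) * code y o = E.a * code y o') : code y o = code y o' := by
  have key : ∀ p ∈ ({1, (E.b : WithOne E), (E.c : WithOne E)} : Set (WithOne E)),
      ∀ q ∈ ({1, (E.b : WithOne E), (E.c : WithOne E)} : Set (WithOne E)),
      (E.a : WithOne E) * p = E.a * q → p = q := by
    have hb : (E.a : WithOne E) * E.b = E.zero := rfl
    have hc : (E.a : WithOne E) * E.c = E.ac := rfl
    rintro p (rfl | rfl | rfl) q (rfl | rfl | rfl) <;>
      simp [hb, hc]
  refine key _ ?_ _ ?_ h
  · cases o with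
    | none => simp [code]
    | some i => by_cases h : i = y <;> simp [code, h]
  · cases o' with
    | none => simp [code]
    | some i => by_cases h : i = y <;> simp [code, h]

theorem find?_eq_of_code_eq {y z : ℕ} {w w' : List ℕ}
    (h : code y (w.find? fun a => a = y ∨ a = z) = code y (w'.find? fun a => a = y ∨ a = z)) :
    w.find? (fun a => a = y ∨ a = z) = w'.find? fun a => a = y ∨ a = z := by
  have hs : ∀ {w : List ℕ} {i : ℕ}, (w.find? fun a => a = y ∨ a = z) = some i →
      i = y ∨ i = z := fun h => by simpa using List.find?_some h
  rcases h₁ : w.find? (fun a => a = y ∨ a = z) with _ | i <;>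
    rcases h₂ : w'.find? (fun a => a = y ∨ a = z) with _ | j <;>
    rw [h₁, h₂] at h
  · by_cases hj : j = y <;> simp [code, hj] at h
  · by_cases hi : i = y <;> simp [code, hi] at h
  · have hi := hs h₁
    have hj := hs h₂
    by_cases hi' : i = y <;> by_cases hj' : j = y <;> simp [code, hi', hj'] at h ⊢
    all_goals omega

theorem ini_eq_of_assign {t : ℕ} {w w' : List ℕ} (hw : t ∉ w) (hw' : t ∉ w')
    (h : ∀ y z, val (assign t y z) w = val (assign t y z) w') : ini w = ini w' :=
  ini_eq_of_find?_eq fun y z => find?_eq_of_code_eq (by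
    rw [← val_assign y z hw, ← val_assign y z hw', h])

theorem ini_eq_of_assign_append {t : ℕ} {p p' w w' : List ℕ} (hp : t ∉ p) (hp' : t ∉ p')
    (hw : t ∉ w) (hw' : t ∉ w')
    (h : ∀ y z, val (assign t y z) (p ++ t :: w) = val (assign t y z) (p' ++ t :: w')) :
    ini w = ini w' := by
  refine ini_eq_of_assign hw hw' fun y z => ?_
  have := h y z
  have ht : assign t y z t = E.a := by simp [assign]
  rw [val_append, val_append, val_cons, val_cons, val_assign y z hp, val_assign y z hp',
    val_assign y z hw, val_assign y z hw', ht, code_mul_a_mul_code, code_mul_a_mul_code] at this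
  rw [val_assign y z hw, val_assign y z hw', a_mul_code_injective this]

theorem val_single (t : ℕ) (w : List ℕ) :
    val (fun i => if i = t then (E.a : WithOne E) else 1) w = (E.a : WithOne E) ^ w.count t := by
  induction w with
  | nil => simp
  | cons i w ih =>
    by_cases h : i = t
    · subst h; simp [ih, pow_succ']
    · simp [h, ih]

theorem a_pow_eq_a_iff (n : ℕ) : (E.a : WithOne E) ^ n = E.a ↔ n = 1 := by
  have h0 : ∀ n, (E.a : WithOne E) ^ (n + 2) = E.zero := by
    intro n
    induction n with
    | zero => rfl
    | succ n ih => rw [pow_succ, ih]; rfl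
  match n with
  | 0 => simp
  | 1 => simp
  | n + 2 => simp [h0]

/-- Identities of `E¹` preserve the letters that occur once. -/
theorem count_eq_one_iff {e : Identity} (h : Satisfies (WithOne E) e) (t : ℕ) :
    e.1.toList.count t = 1 ↔ e.2.toList.count t = 1 := by
  have := h (FreeMonoid.lift fun i => if i = t then (E.a : WithOne E) else 1)
  rw [lift_eq_val, lift_eq_val, val_single, val_single] at this
  rw [← a_pow_eq_a_iff, this, a_pow_eq_a_iff]

theorem val_reverse_eq {M : Type*} [Monoid M] {e : Identity} (h : Satisfies Mᵐᵒᵖ e)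
    (g : ℕ → M) : val g e.1.toList.reverse = val g e.2.toList.reverse := by
  have key : ∀ w : Word, FreeMonoid.lift (fun i => MulOpposite.op (g i)) w =
      MulOpposite.op (val g w.toList.reverse) := fun w => by
    rw [lift_eq_val, val, val, MulOpposite.op_list_prod, List.map_reverse, List.map_reverse,
      List.reverse_reverse, List.map_map]
    rfl
  have := h (FreeMonoid.lift fun i => MulOpposite.op (g i))
  rw [key, key] at this
  exact MulOpposite.op_injective this

/-- Identities of the dual of `E¹` preserve the order of the last occurrences. -/
theorem dedup_eq {e : Identity} (h : Satisfies (WithOne E)ᵐᵒᵖ e) :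
    e.1.toList.dedup = e.2.toList.dedup := by
  obtain ⟨t, ht⟩ := Infinite.exists_notMem_finset (e.1.toList ++ e.2.toList).toFinset
  simp only [List.mem_toFinset, List.mem_append, not_or] at ht
  have := ini_eq_of_assign (t := t) (by simpa using ht.1) (by simpa using ht.2)
    fun y z => val_reverse_eq h (assign t y z)
  rw [ini_reverse, ini_reverse] at this
  exact List.reverse_injective this

/-- Identities of the dual of `E¹` preserve the order of the last occurrences before a letter
that occurs once. -/
theorem dedup_takeWhile_eq {e : Identity} (h : Satisfies (WithOne E)ᵐᵒᵖ e) {t : ℕ}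
    (h₁ : e.1.toList.count t = 1) (h₂ : e.2.toList.count t = 1) :
    (e.1.toList.takeWhile (· ≠ t)).dedup = (e.2.toList.takeWhile (· ≠ t)).dedup := by
  have split : ∀ {w : List ℕ}, w.count t = 1 → ∃ p q, w = p ++ t :: q ∧ t ∉ p ∧ t ∉ q := by
    intro w hw
    obtain ⟨p, q, rfl, hp⟩ := List.eq_append_cons_of_mem
      (List.count_pos_iff.1 (by omega : 0 < w.count t))
    refine ⟨p, q, rfl, hp, ?_⟩
    rw [List.count_append, List.count_cons_self, List.count_eq_zero.2 hp] at hw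
    exact List.count_eq_zero.1 (by omega)
  obtain ⟨p, q, e₁, hp, hq⟩ := split h₁
  obtain ⟨p', q', e₂, hp', hq'⟩ := split h₂
  rw [e₁, e₂, takeWhile_append_cons hp, takeWhile_append_cons hp']
  have := ini_eq_of_assign_append (t := t) (p := q.reverse) (p' := q'.reverse)
    (w := p.reverse) (w' := p'.reverse) (by simpa) (by simpa) (by simpa) (by simpa) fun y z => by
      have := val_reverse_eq h (assign t y z)
      rw [e₁, e₂] at this
      simpa using this
  rw [ini_reverse, ini_reverse] at this
  exact List.reverse_injective this

/-- The congruence of words that agree in the order of first occurrences after the last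
occurrence of each letter. -/
def afterCon : Con Word where
  r u v := ∀ a, ini (aft a u.toList) = ini (aft a v.toList)
  iseqv := ⟨fun _ _ => rfl, fun h a => (h a).symm, fun h h' a => (h a).trans (h' a)⟩
  mul' := by
    intro u u' w w' hu hw a
    have hi := ini_eq_of_aft hw
    rw [FreeMonoid.toList_mul, FreeMonoid.toList_mul]
    by_cases h : a ∈ w.toList
    · have h' : a ∈ w'.toList := by rwa [← mem_ini, ← hi, mem_ini]
      rw [aft_append_of_mem h, aft_append_of_mem h', hw]
    · have h' : a ∉ w'.toList := by rwa [← mem_ini, ← hi, mem_ini]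
      rw [aft_append_of_notMem h, aft_append_of_notMem h', ini_append_congr (hu a) hi]

theorem afterCon_sq (u : Word) : afterCon u (u ^ 2) := by
  intro a
  rw [pow_two, FreeMonoid.toList_mul]
  by_cases h : a ∈ u.toList
  · rw [aft_append_of_mem h]
  · rw [aft_append_of_notMem h, aft_of_notMem h, ini_append_of_subset (List.Subset.refl _)]

/-- The longer side ends in `u * v * w`. If `a` occurs there, only that final copy matters;
otherwise the insertions repeat earlier letters and leave `ini` unchanged. -/
theorem afterCon_insert (u v w : Word) :
    afterCon (u * v * w) (u * v * u * w * u * v * w) := by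
  intro a
  simp only [FreeMonoid.toList_mul]
  generalize u.toList = p, v.toList = q, w.toList = l
  have e : p ++ q ++ p ++ l ++ p ++ q ++ l = (p ++ q ++ p ++ l) ++ (p ++ q ++ l) := by simp
  by_cases h : a ∈ p ++ q ++ l
  · rw [e, aft_append_of_mem h]
  · have h' : a ∉ p ++ q ++ p ++ l ++ p ++ q ++ l := by
      simp only [List.mem_append] at h ⊢
      tauto
    rw [aft_of_notMem h, aft_of_notMem h']
    have sub : ∀ {l l' : List ℕ}, l ⊆ l' → (ini l).filter (· ∉ l') = [] := by
      intro l l' hl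
      refine List.filter_eq_nil_iff.2 fun a ha => ?_
      simpa using hl (mem_ini.1 ha)
    have e' : p ++ q ++ p ++ l ++ p ++ q ++ l = (p ++ q) ++ p ++ (l ++ (p ++ q ++ l)) := by simp
    have h₁ : ini (p ++ q ++ p) = ini (p ++ q) := ini_append_of_subset (by simp)
    rw [e', ini_append_congr h₁ (rfl : ini (l ++ (p ++ q ++ l)) = _), ← List.append_assoc]
    exact (ini_append_of_subset (by simp)).symm

theorem satisfies_afterCon {e : Identity} (he : e ∈ ({(x, x ^ 2),
    (x * y * z, x * y * x * z * x * y * z)} : Set Identity)) :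
    Satisfies afterCon.Quotient e := by
  intro φ
  rcases he with rfl | rfl
  · simp only [map_pow]
    induction φ x using Con.induction_on with
    | H u => exact (Con.eq _).2 (afterCon_sq u)
  · simp only [map_mul]
    induction φ x using Con.induction_on with
    | H u =>
      induction φ y using Con.induction_on with
      | H v =>
        induction φ z using Con.induction_on with
        | H w => exact (Con.eq _).2 (afterCon_insert u v w)

/-- Identities of all members of `varR3` preserve the order of the first occurrences after the
last occurrence of each letter. -/
theorem ini_aft_eq {e : Identity} (h : ∀ N ∈ varR3.{u}, Satisfies N e) (a : ℕ) :
    ini (aft a e.1.toList) = ini (aft a e.2.toList) := by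
  have h₁ : Satisfies (ULift.{u} afterCon.Quotient) e :=
    h (MonCat.of (ULift.{u} afterCon.Quotient)) fun e he =>
      (satisfies_afterCon he).of_mulEquiv MulEquiv.ulift
  have h₂ : Satisfies afterCon.Quotient e :=
    h₁.of_mulEquiv MulEquiv.ulift.symm
  exact (Con.eq _).1 (h₂ afterCon.mk') a

/-! ### The bases -/

section

variable {M : Type*} [Monoid M]

theorem satisfies_basisXY_iff : (∀ e ∈ basisXY, Satisfies M e) ↔
    (∀ x t : M, x * t * x = x * t * x ^ 2) ∧ (∀ x t : M, x * t * x ^ 2 = x ^ 2 * t * x) ∧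
    (∀ x y : M, x ^ 2 * y ^ 2 = (x * y) ^ 2) ∧
    ∀ x y t s : M, x * y * t ^ 2 * x * s * y = x * y * x * t ^ 2 * x * s * y := by
  constructor
  · intro h
    have key : ∀ a b c d : M, ∃ φ : Word →* M, φ x = a ∧ φ y = b ∧ φ t = c ∧ φ s = d :=
      fun a b c d => ⟨FreeMonoid.lift fun i =>
        if i = 0 then a else if i = 1 then b else if i = 3 then c else d, rfl, rfl, rfl, rfl⟩
    refine ⟨fun a c => ?_, fun a c => ?_, fun a b => ?_, fun a b c d => ?_⟩
    · obtain ⟨φ, rfl, -, rfl, -⟩ := key a 1 c 1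
      have : φ (x * t * x) = φ (x * t * x ^ 2) :=
        h (x * t * x, x * t * x ^ 2) (by simp [basisXY]) φ
      simpa only [map_mul, map_pow] using this
    · obtain ⟨φ, rfl, -, rfl, -⟩ := key a 1 c 1
      have : φ (x * t * x ^ 2) = φ (x ^ 2 * t * x) :=
        h (x * t * x ^ 2, x ^ 2 * t * x) (by simp [basisXY]) φ
      simpa only [map_mul, map_pow] using this
    · obtain ⟨φ, rfl, rfl, -, -⟩ := key a b 1 1
      have : φ (x ^ 2 * y ^ 2) = φ ((x * y) ^ 2) :=
        h (x ^ 2 * y ^ 2, (x * y) ^ 2) (by simp [basisXY]) φ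
      simpa only [map_mul, map_pow] using this
    · obtain ⟨φ, rfl, rfl, rfl, rfl⟩ := key a b c d
      have : φ (x * y * t ^ 2 * x * s * y) = φ (x * y * x * t ^ 2 * x * s * y) :=
        h (x * y * t ^ 2 * x * s * y, x * y * x * t ^ 2 * x * s * y) (by simp [basisXY]) φ
      simpa only [map_mul, map_pow] using this
  · rintro ⟨h₁, h₂, h₃, h₄⟩ e (rfl | rfl | rfl | rfl) φ <;> simp only [map_mul, map_pow]
    exacts [h₁ _ _, h₂ _ _, h₃ _ _, h₄ _ _ _ _]

theorem satisfies_basisYX_iff : (∀ e ∈ basisYX, Satisfies M e) ↔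
    (∀ x t : M, x * t * x = x * t * x ^ 2) ∧ (∀ x t : M, x * t * x ^ 2 = x ^ 2 * t * x) ∧
    (∀ x y : M, x ^ 2 * y ^ 2 = (x * y) ^ 2) ∧
    ∀ x y t s : M, x * y * t ^ 2 * y * s * x = x * y * x * t ^ 2 * y * s * x := by
  constructor
  · intro h
    have key : ∀ a b c d : M, ∃ φ : Word →* M, φ x = a ∧ φ y = b ∧ φ t = c ∧ φ s = d :=
      fun a b c d => ⟨FreeMonoid.lift fun i =>
        if i = 0 then a else if i = 1 then b else if i = 3 then c else d, rfl, rfl, rfl, rfl⟩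
    refine ⟨fun a c => ?_, fun a c => ?_, fun a b => ?_, fun a b c d => ?_⟩
    · obtain ⟨φ, rfl, -, rfl, -⟩ := key a 1 c 1
      have : φ (x * t * x) = φ (x * t * x ^ 2) :=
        h (x * t * x, x * t * x ^ 2) (by simp [basisYX]) φ
      simpa only [map_mul, map_pow] using this
    · obtain ⟨φ, rfl, -, rfl, -⟩ := key a 1 c 1
      have : φ (x * t * x ^ 2) = φ (x ^ 2 * t * x) :=
        h (x * t * x ^ 2, x ^ 2 * t * x) (by simp [basisYX]) φ
      simpa only [map_mul, map_pow] using this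
    · obtain ⟨φ, rfl, rfl, -, -⟩ := key a b 1 1
      have : φ (x ^ 2 * y ^ 2) = φ ((x * y) ^ 2) :=
        h (x ^ 2 * y ^ 2, (x * y) ^ 2) (by simp [basisYX]) φ
      simpa only [map_mul, map_pow] using this
    · obtain ⟨φ, rfl, rfl, rfl, rfl⟩ := key a b c d
      have : φ (x * y * t ^ 2 * y * s * x) = φ (x * y * x * t ^ 2 * y * s * x) :=
        h (x * y * t ^ 2 * y * s * x, x * y * x * t ^ 2 * y * s * x) (by simp [basisYX]) φ
      simpa only [map_mul, map_pow] using this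
  · rintro ⟨h₁, h₂, h₃, h₄⟩ e (rfl | rfl | rfl | rfl) φ <;> simp only [map_mul, map_pow]
    exacts [h₁ _ _, h₂ _ _, h₃ _ _, h₄ _ _ _ _]

theorem isIdempotentElem_mul_of_sq (h : ∀ x y : M, x ^ 2 * y ^ 2 = (x * y) ^ 2) {a b : M}
    (ha : IsIdempotentElem a) (hb : IsIdempotentElem b) : IsIdempotentElem (a * b) := by
  have := h a b
  rw [pow_two, pow_two, pow_two, ha.eq, hb.eq] at this
  exact this.symm

theorem InsertionLaws.of_basisXY {M : Type u} [Monoid M]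
    (h : ∀ e ∈ basisXY, Satisfies M e) : InsertionLaws M := by
  obtain ⟨h₁, h₂, h₃, h₄⟩ := satisfies_basisXY_iff.1 h
  have idem : ∀ {a b : M}, IsIdempotentElem a → IsIdempotentElem b →
    IsIdempotentElem (a * b) := isIdempotentElem_mul_of_sq h₃
  have near : ∀ {a b e : M}, IsIdempotentElem e → ∀ s,
      a * b * e * a * s * b = a * b * a * e * a * s * b := fun {a b e} he s => by
    have := h₄ a b e s
    rwa [pow_two, he.eq] at this
  refine ⟨fun x t => by rw [h₁, pow_two], fun x t => by rw [h₁, h₂, pow_two], idem,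
    fun _ _ he s => near he s, fun {a b e} ha hb he s => ?_⟩
  -- Once `ab` is doubled, the `b` before `e` is deleted by the near law with `a` and `b` exchanged,
  -- which leaves `aba`.
  calc a * b * e * b * s * a = a * b * (a * b) * e * b * s * a := by rw [(idem ha hb).eq]
    _ = a * (b * a * b * e * b * s * a) := by simp only [mul_assoc]
    _ = a * (b * a * e * b * s * a) := by rw [near he]
    _ = a * b * a * e * b * s * a := by simp only [mul_assoc]

theorem InsertionLaws.of_basisYX {M : Type u} [Monoid M]
    (h : ∀ e ∈ basisYX, Satisfies M e) : InsertionLaws M := by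
  obtain ⟨h₁, h₂, h₃, h₄⟩ := satisfies_basisYX_iff.1 h
  have idem : ∀ {a b : M}, IsIdempotentElem a → IsIdempotentElem b →
    IsIdempotentElem (a * b) := isIdempotentElem_mul_of_sq h₃
  have far : ∀ {a b e : M}, IsIdempotentElem e → ∀ s,
      a * b * e * b * s * a = a * b * a * e * b * s * a := fun {a b e} he s => by
    have := h₄ a b e s
    rwa [pow_two, he.eq] at this
  refine ⟨fun x t => by rw [h₁, pow_two], fun x t => by rw [h₁, h₂, pow_two], idem,
    fun {a b e} ha hb he s => ?_, fun _ _ he s => far he s⟩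
  calc a * b * e * a * s * b = a * b * (a * b) * e * a * s * b := by rw [(idem ha hb).eq]
    _ = a * (b * a * b * e * a * s * b) := by simp only [mul_assoc]
    _ = a * (b * a * e * a * s * b) := by rw [far he]
    _ = a * b * a * e * a * s * b := by simp only [mul_assoc]

/-- In a band, an element absorbs products of two of its factors. -/
theorem mul_mul_mul_self_of_band (hb : ∀ a : M, a * a = a) {z x y a₁ b₁ a₂ b₂ : M}
    (h₁ : z = a₁ * x * b₁) (h₂ : z = a₂ * y * b₂) : z * (x * y) * z = z := by
  have e₁ : z * x * b₁ = z := by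
    have := hb (x * b₁)
    calc z * x * b₁ = a₁ * ((x * b₁) * (x * b₁)) := by rw [h₁]; simp only [mul_assoc]
      _ = z := by rw [this, h₁, mul_assoc]
  have e₂ : z * x * y * (b₂ * x) = z * x := by
    have := hb (y * (b₂ * x))
    calc z * x * y * (b₂ * x) = a₂ * ((y * (b₂ * x)) * (y * (b₂ * x))) := by
          rw [h₂]; simp only [mul_assoc]
      _ = z * x := by rw [this, h₂]; simp only [mul_assoc]
  -- Right multiplication of `z` by `xy` can be undone, so idempotency of `z * (x * y)` yields the
  -- claim.
  have e₃ : z * (x * y) * (b₂ * x * b₁) = z := by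
    rw [← mul_assoc z, ← mul_assoc _ (b₂ * x), e₂, e₁]
  calc z * (x * y) * z = z * (x * y) * (z * (x * y)) * (b₂ * x * b₁) := by
        rw [mul_assoc _ (z * (x * y)), e₃]
    _ = z := by rw [hb, e₃]

/-- The law of `varR3` gives `xyz = xyx(z·xy·z)`, and `z` absorbs `xy`. -/
theorem insert_of_band (hb : ∀ a : M, a * a = a)
    (h : ∀ a b c : M, a * b * c = a * b * a * c * a * b * c) {z x y a₁ b₁ a₂ b₂ : M}
    (h₁ : z = a₁ * x * b₁) (h₂ : z = a₂ * y * b₂) : x * y * z = x * y * x * z := by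
  calc x * y * z = x * y * x * (z * (x * y) * z) := by rw [h]; simp only [mul_assoc]
    _ = x * y * x * z := by rw [mul_mul_mul_self_of_band hb h₁ h₂]

end

/-! ### The generators satisfy both bases -/

theorem band_of_mem_varR3 {M : MonCat.{u}} (hM : M ∈ varR3) :
    (∀ a : M, a * a = a) ∧ ∀ a b c : M, a * b * c = a * b * a * c * a * b * c := by
  have key : ∀ a b c : M, ∃ φ : Word →* M, φ x = a ∧ φ y = b ∧ φ z = c :=
    fun a b c => ⟨FreeMonoid.lift fun i => if i = 0 then a else if i = 1 then b else c,
      rfl, rfl, rfl⟩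
  constructor
  · intro a
    obtain ⟨φ, rfl, -⟩ := key a 1 1
    have : φ x = φ (x ^ 2) := hM (x, x ^ 2) (by simp) φ
    rw [map_pow, pow_two] at this
    exact this.symm
  · intro a b c
    obtain ⟨φ, rfl, rfl, rfl⟩ := key a b c
    simpa using hM (x * y * z, x * y * x * z * x * y * z) (by simp) φ

theorem varR3_subset_basisXY : varR3.{u} ⊆ var basisXY := by
  intro M hM
  obtain ⟨hb, h⟩ := band_of_mem_varR3 hM
  refine satisfies_basisXY_iff.2 ⟨fun a c => ?_, fun a c => ?_, fun a b => ?_,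
    fun a b c d => ?_⟩
  · rw [pow_two, hb]
  · rw [pow_two, hb]
  · rw [pow_two, pow_two, pow_two, hb, hb, hb]
  · have := insert_of_band hb h (z := c ^ 2 * a * d * b) (x := a) (y := b)
      (a₁ := c ^ 2) (b₁ := d * b) (a₂ := c ^ 2 * a * d) (b₂ := 1)
      (by simp only [mul_assoc]) (by simp)
    simpa only [mul_assoc] using this

theorem varR3_subset_basisYX : varR3.{u} ⊆ var basisYX := by
  intro M hM
  obtain ⟨hb, h⟩ := band_of_mem_varR3 hM
  refine satisfies_basisYX_iff.2 ⟨fun a c => ?_, fun a c => ?_, fun a b => ?_,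
    fun a b c d => ?_⟩
  · rw [pow_two, hb]
  · rw [pow_two, hb]
  · rw [pow_two, pow_two, pow_two, hb, hb, hb]
  · have := insert_of_band hb h (z := c ^ 2 * b * d * a) (x := a) (y := b)
      (a₁ := c ^ 2 * b * d) (b₁ := 1) (a₂ := c ^ 2) (b₂ := d * a)
      (by simp) (by simp only [mul_assoc])
    simpa only [mul_assoc] using this

instance : Fintype E where
  elems := {E.zero, E.a, E.b, E.c, E.ac}
  complete e := by cases e <;> simp

instance : Fintype (WithOne E) := inferInstanceAs (Fintype (Option E))

instance : DecidableEq (WithOne E) := inferInstanceAs (DecidableEq (Option E))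

theorem satisfies_basisXY_E : ∀ e ∈ basisXY, Satisfies (WithOne E) e :=
  satisfies_basisXY_iff.2 (by decide +kernel)

theorem satisfies_basisYX_E : ∀ e ∈ basisYX, Satisfies (WithOne E) e :=
  satisfies_basisYX_iff.2 (by decide +kernel)

theorem satisfies_basisXY_op_E : ∀ e ∈ basisXY, Satisfies (WithOne E)ᵐᵒᵖ e := by
  have h : (∀ x t : WithOne E, x * (t * x) = x ^ 2 * (t * x)) ∧
      (∀ x t : WithOne E, x ^ 2 * (t * x) = x * (t * x ^ 2)) ∧
      (∀ x y : WithOne E, y ^ 2 * x ^ 2 = (y * x) ^ 2) ∧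
      ∀ x y t s : WithOne E, y * (s * (x * (t ^ 2 * (y * x)))) =
        y * (s * (x * (t ^ 2 * (x * (y * x))))) := by
    decide +kernel
  obtain ⟨h₁, h₂, h₃, h₄⟩ := h
  exact satisfies_basisXY_iff.2 ⟨fun x t => MulOpposite.unop_injective (h₁ _ _),
    fun x t => MulOpposite.unop_injective (h₂ _ _),
    fun x y => MulOpposite.unop_injective (h₃ _ _),
    fun x y t s => MulOpposite.unop_injective (h₄ _ _ _ _)⟩

theorem satisfies_basisYX_op_E : ∀ e ∈ basisYX, Satisfies (WithOne E)ᵐᵒᵖ e := by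
  have h : (∀ x t : WithOne E, x * (t * x) = x ^ 2 * (t * x)) ∧
      (∀ x t : WithOne E, x ^ 2 * (t * x) = x * (t * x ^ 2)) ∧
      (∀ x y : WithOne E, y ^ 2 * x ^ 2 = (y * x) ^ 2) ∧
      ∀ x y t s : WithOne E, x * (s * (y * (t ^ 2 * (y * x)))) =
        x * (s * (y * (t ^ 2 * (x * (y * x))))) := by
    decide +kernel
  obtain ⟨h₁, h₂, h₃, h₄⟩ := h
  exact satisfies_basisYX_iff.2 ⟨fun x t => MulOpposite.unop_injective (h₁ _ _),
    fun x t => MulOpposite.unop_injective (h₂ _ _),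
    fun x y => MulOpposite.unop_injective (h₃ _ _),
    fun x y t s => MulOpposite.unop_injective (h₄ _ _ _ _)⟩

/-- The join is contained in every class `var I` that contains its three generators. -/
theorem join_subset_var {I : Set Identity} (h₁ : ∀ e ∈ I, Satisfies (WithOne E) e)
    (h₂ : ∀ e ∈ I, Satisfies (WithOne E)ᵐᵒᵖ e) (h₃ : varR3.{u} ⊆ var I) :
    join (join varE (dual varE)) varR3 ⊆ var.{u} I := by
  have hE : varE.{u} ⊆ var I := generated_subset (isVariety_var I) (by
    rintro _ rfl e he
    exact (h₁ e he).of_mulEquiv MulEquiv.ulift)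
  -- The monoids whose opposites satisfy `I` form a variety containing `E¹`, hence all of `varE`;
  -- this settles the dual.
  have hE' : varE.{u} ⊆ {M : MonCat.{u} | ∀ e ∈ I, Satisfies (M : Type u)ᵐᵒᵖ e} :=
    generated_subset (isVariety_op_var I) (by
      rintro _ rfl e he
      exact (h₂ e he).of_mulEquiv (MulEquiv.op MulEquiv.ulift))
  refine generated_subset (isVariety_var I) (Set.union_subset ?_ h₃)
  refine generated_subset (isVariety_var I) (Set.union_subset hE ?_)
  rintro M ⟨N, hN, ⟨f⟩⟩ e he
  exact (hE' hN e he).of_mulEquiv f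

/-- Every monoid with the insertion laws belongs to the join. -/
theorem mem_join_of_insertionLaws {M : MonCat.{u}} (hM : InsertionLaws M) :
    M ∈ join (join varE (dual varE)) varR3 := by
  have hE : MonCat.of (ULift.{u} (WithOne E)) ∈ varE.{u} := subset_generated _ rfl
  refine (isVariety_generated _).mem_of_satisfies M fun e he => ?_
  have h₁ : Satisfies (WithOne E) e :=
    (he _ (subset_generated _ (Or.inl (subset_generated _ (Or.inl hE))))).of_mulEquiv
      MulEquiv.ulift.symm
  have h₂ : Satisfies (WithOne E)ᵐᵒᵖ e :=
    (he (MonCat.of (ULift.{u} (WithOne E))ᵐᵒᵖ) (subset_generated _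
      (Or.inl (subset_generated _ (Or.inr ⟨_, hE, ⟨MulEquiv.refl _⟩⟩))))).of_mulEquiv
      (MulEquiv.op MulEquiv.ulift.symm)
  have h₃ := ini_aft_eq fun N hN => he N (subset_generated _ (Or.inr hN))
  have hbal : Balanced e.1.toList e.2.toList :=
    ⟨count_eq_one_iff h₁, dedup_eq h₂,
      fun t ht => dedup_takeWhile_eq h₂ ht ((count_eq_one_iff h₁ t).1 ht), h₃⟩
  intro φ
  rw [← FreeMonoid.lift_restrict φ, lift_eq_val, lift_eq_val]
  exact hM.val_eq_of_balanced hbal _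

theorem isBasis_basisXY :
    IsBasis.{u} basisXY (join (join varE (dual varE)) varR3) :=
  (join_subset_var satisfies_basisXY_E satisfies_basisXY_op_E varR3_subset_basisXY).antisymm
    fun _ hM => mem_join_of_insertionLaws (InsertionLaws.of_basisXY hM)

theorem isBasis_basisYX :
    IsBasis.{u} basisYX (join (join varE (dual varE)) varR3) :=
  (join_subset_var satisfies_basisYX_E satisfies_basisYX_op_E varR3_subset_basisYX).antisymm
    fun _ hM => mem_join_of_insertionLaws (InsertionLaws.of_basisYX hM)

end MonoidVar

theorem mainTheorem10 :
    MonoidVar.FinitelyBased.{u}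
      (MonoidVar.join (MonoidVar.join MonoidVar.varE (MonoidVar.dual MonoidVar.varE))
        MonoidVar.varR3) ∧
    MonoidVar.IsBasis.{u} MonoidVar.basisXY
      (MonoidVar.join (MonoidVar.join MonoidVar.varE (MonoidVar.dual MonoidVar.varE))
        MonoidVar.varR3) ∧
    MonoidVar.IsBasis.{u} MonoidVar.basisYX
      (MonoidVar.join (MonoidVar.join MonoidVar.varE (MonoidVar.dual MonoidVar.varE))
        MonoidVar.varR3) :=
  ⟨⟨MonoidVar.basisXY, by simp [MonoidVar.basisXY], MonoidVar.isBasis_basisXY⟩,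
    MonoidVar.isBasis_basisXY, MonoidVar.isBasis_basisYX⟩
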